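/- For a bounded set $E\subseteq\mathbb R$ and $r>0$, let $N(E,r)$ be the least number of closed balls of radius $r$ (that is, closed intervals of length $2r$) needed to cover $E$, and let $$\overline{\dim}_M E=\limsup_{r\downarrow 0}\frac{\log N(E,r)}{\log(1/r)}\qquad(\log 0:=-\infty)$$ be the upper Minkowski dimension of $E$. For $A\subseteq\mathbb R$, put $$Q(A)=\Big\{\frac{a-b}{c-d} : a,b,c,d\in A,\ c\neq d\Big\}.$$ Lemma. Let $E\subseteq\mathbb R$ be bounded with $\overline{\dim}_M E>0$. Then there exist $n\in\mathbb N$ and a linear map $T\colon\mathbb R^n\to\mathbb R$ such that $Q(T(E^n))$ is dense in $\mathbb R$. -/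

import Mathlib

open Filter Topology
open scoped NNReal ENNReal

/-- The upper Minkowski (box-counting) dimension of a set `E` in a metric space:
`limsup_{r ↓ 0} log N(E, r) / log (1 / r)`, where `N(E, r)` is the least number of closed balls of
radius `r` (centred anywhere in the space) that cover `E`. It takes values in `[-∞, ∞]`, and
`ENNReal.log 0 = -∞`. -/
noncomputable def upperMinkowskiDim {X : Type*} [PseudoEMetricSpace X] (E : Set X) : EReal :=
  limsup
    (fun r : ℝ≥0 =>
      ENNReal.log ((Metric.externalCoveringNumber r E : ℕ∞) : ℝ≥0∞) /
        ((Real.log (1 / (r : ℝ)) : ℝ) : EReal))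
    (𝓝[>] 0)

/-- The quotient set `Q(E) = {(a - b) / (c - d) : a, b, c, d ∈ E, c ≠ d}`. -/
def quotientSet (E : Set ℝ) : Set ℝ :=
  {x | ∃ a ∈ E, ∃ b ∈ E, ∃ c ∈ E, ∃ d ∈ E, c ≠ d ∧ x = (a - b) / (c - d)}

/-! If Q(A) misses an ε-ball around x, then (a, c) ↦ a - xc keeps F × F separated at a scale
comparable to r for every r-separated F ⊆ A. Hence A - xA has |F|² points at essentially the same
scale, and the growth exponent halves (`HasSeparatedGrowth.sub_mul`). If A is a linear image of Eⁿ,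
A - xA is one of E²ⁿ. Positive dimension gives exponent 2^k for some k; without density at any
stage, k halvings reach exponent 1, impossible in a bounded set. -/

/-- `A` contains finite `r`-separated sets `F`, `r < 1`, with `|F| ^ m * r` arbitrarily large. -/
def HasSeparatedGrowth (A : Set ℝ) (m : ℕ) : Prop :=
  ∀ K : ℝ, ∃ r : ℝ, 0 < r ∧ r < 1 ∧ ∃ F : Finset ℝ, (F : Set ℝ) ⊆ A ∧
    (∀ a ∈ F, ∀ b ∈ F, a ≠ b → r ≤ |a - b|) ∧ K ≤ (F.card : ℝ) ^ m * r

theorem HasSeparatedGrowth.mono {A B : Set ℝ} {m : ℕ} (hA : HasSeparatedGrowth A m)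
    (h : A ⊆ B) : HasSeparatedGrowth B m := by
  intro K
  obtain ⟨r, h0, h1, F, hF, hs, hK⟩ := hA K
  exact ⟨r, h0, h1, F, hF.trans h, hs, hK⟩

/-- A finite `r`-separated subset of `[-R, R]` has at most about `2 * R / r` elements. -/
theorem card_mul_le_of_separated {R r : ℝ} (hr : 0 < r) (hr1 : r < 1) (hR : 0 ≤ R)
    (F : Finset ℝ) (hF : ∀ a ∈ F, |a| ≤ R) (hs : ∀ a ∈ F, ∀ b ∈ F, a ≠ b → r ≤ |a - b|) :
    (F.card : ℝ) * r ≤ 2 * R + 2 := by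
  have hcard : F.card ≤ (Finset.Icc ⌊-R / r⌋ ⌊R / r⌋).card := by
    -- Two points in one cell of length r are less than r apart.
    refine Finset.card_le_card_of_injOn (fun x => ⌊x / r⌋) ?_ ?_
    · intro x hx
      have hx := abs_le.1 (hF x hx)
      simp only [Finset.coe_Icc, Set.mem_Icc]
      exact ⟨Int.floor_le_floor (by gcongr; exact hx.1), Int.floor_le_floor (by gcongr; exact hx.2)⟩
    · intro x hx y hy hxy
      by_contra hne
      have h1 := Int.abs_sub_lt_one_of_floor_eq_floor hxy
      rw [← sub_div, abs_div, abs_of_pos hr, div_lt_one hr] at h1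
      exact absurd (hs x hx y hy hne) (not_le.2 h1)
  have hle : ⌊-R / r⌋ ≤ ⌊R / r⌋ := Int.floor_le_floor (by gcongr; linarith)
  rw [Int.card_Icc] at hcard
  have hcast : (F.card : ℝ) ≤ ⌊R / r⌋ + 1 - ⌊-R / r⌋ := by
    have : (F.card : ℤ) ≤ ⌊R / r⌋ + 1 - ⌊-R / r⌋ := by omega
    exact_mod_cast this
  have h1 := Int.floor_le (R / r)
  have h2 := Int.sub_one_lt_floor (-R / r)
  calc (F.card : ℝ) * r ≤ (R / r + 2 - -R / r) * r := by gcongr; linarith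
    _ = 2 * R + 2 * r := by field_simp; ring
    _ ≤ 2 * R + 2 := by linarith

theorem not_hasSeparatedGrowth_one {A : Set ℝ} (hA : Bornology.IsBounded A) :
    ¬ HasSeparatedGrowth A 1 := by
  intro h
  obtain ⟨R, hR0, hR⟩ := hA.exists_pos_norm_le
  obtain ⟨r, h0, h1, F, hF, hs, hK⟩ := h (2 * R + 3)
  have := card_mul_le_of_separated h0 h1 hR0.le F (fun a ha => hR a (hF ha)) hs
  rw [pow_one] at hK
  linarith

/-- If the quotient set of `A` misses the `ε`-ball around `x`, then `(a, c) ↦ a - x * c` does not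
contract the separation of `A × A` by more than a constant. -/
theorem HasSeparatedGrowth.sub_mul {A : Set ℝ} {m : ℕ} (hA : HasSeparatedGrowth A (2 * m))
    {x ε : ℝ} (hε : 0 < ε) (hx : ∀ y ∈ quotientSet A, ε ≤ |y - x|) :
    HasSeparatedGrowth {z | ∃ a ∈ A, ∃ c ∈ A, z = a - x * c} m := by
  have key : ∀ a ∈ A, ∀ b ∈ A, ∀ c ∈ A, ∀ d ∈ A,
      ε * |c - d| ≤ |(a - x * c) - (b - x * d)| := by
    intro a ha b hb c hc d hd
    rcases eq_or_ne c d with rfl | hne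
    · simp
    have h0 : c - d ≠ 0 := sub_ne_zero.2 hne
    calc ε * |c - d| ≤ |(a - b) / (c - d) - x| * |c - d| := by
          gcongr
          exact hx _ ⟨a, ha, b, hb, c, hc, d, hd, hne, rfl⟩
      _ = |(a - x * c) - (b - x * d)| := by
          rw [← abs_mul]; congr 1; field_simp; ring
  -- Only 0 < η ≤ min(1, ε) matters: pairs with c = d are |a - b| ≥ r apart, the others at least ε|c
  -- - d| ≥ εr.
  set η : ℝ := ε / (1 + ε + |x|) with hη
  have hden : 0 < 1 + ε + |x| := by positivity
  have hη0 : 0 < η := by positivity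
  have hη1 : η ≤ 1 := by rw [hη, div_le_one hden]; linarith [abs_nonneg x]
  have hmul : η * (1 + ε + |x|) = ε := div_mul_cancel₀ _ hden.ne'
  intro K
  obtain ⟨r, h0, h1, F, hF, hs, hK⟩ := hA (K / η)
  have hsep : ∀ p ∈ F ×ˢ F, ∀ q ∈ F ×ˢ F, p ≠ q →
      η * r ≤ |(p.1 - x * p.2) - (q.1 - x * q.2)| := by
    rintro ⟨a, c⟩ hp ⟨b, d⟩ hq hne
    rw [Finset.mem_product] at hp hq
    have hk := key a (hF hp.1) b (hF hq.1) c (hF hp.2) d (hF hq.2)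
    dsimp only
    set D := |(a - x * c) - (b - x * d)| with hD
    have hle : ε * r ≤ (1 + ε + |x|) * D := by
      have hD0 : 0 ≤ D := abs_nonneg _
      by_cases hcd : c = d
      · have hab : a ≠ b := fun h => hne (by rw [h, hcd])
        have h2 := hs a hp.1 b hq.1 hab
        have h3 : D = |a - b| := by rw [hD, hcd]; congr 1; ring
        rw [← h3] at h2
        nlinarith [mul_nonneg (abs_nonneg x) hD0, mul_le_mul_of_nonneg_left h2 hε.le]
      · have h2 := hs c hp.2 d hq.2 hcd
        nlinarith [mul_nonneg (abs_nonneg x) hD0, mul_le_mul_of_nonneg_left h2 hε.le]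
    calc η * r = ε * r / (1 + ε + |x|) := by rw [hη]; ring
      _ ≤ D := by rw [div_le_iff₀ hden]; linarith
  have hpos : 0 < η * r := by positivity
  have hinj : Set.InjOn (fun p : ℝ × ℝ => p.1 - x * p.2) (F ×ˢ F : Finset (ℝ × ℝ)) := by
    intro p hp q hq hpq
    by_contra hne
    have h2 := hsep p hp q hq hne
    dsimp only at hpq
    rw [hpq, sub_self, abs_zero] at h2
    linarith
  refine ⟨η * r, hpos, by nlinarith, (F ×ˢ F).image fun p => p.1 - x * p.2, ?_, ?_, ?_⟩
  · intro z hz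
    rw [Finset.mem_coe, Finset.mem_image] at hz
    obtain ⟨p, hp, rfl⟩ := hz
    rw [Finset.mem_product] at hp
    exact ⟨p.1, hF hp.1, p.2, hF hp.2, rfl⟩
  · intro u hu v hv huv
    rw [Finset.mem_image] at hu hv
    obtain ⟨p, hp, rfl⟩ := hu
    obtain ⟨q, hq, rfl⟩ := hv
    exact hsep p hp q hq fun h => huv (by rw [h])
  · rw [Finset.card_image_of_injOn hinj, Finset.card_product]
    rw [div_le_iff₀ hη0, pow_mul] at hK
    push_cast
    rw [← sq]
    linarith

/-- Induction on k, with n and T free because each halving doubles n and replaces T by (u, v) ↦ Tu -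
xTv. -/
theorem exists_dense_quotientSet_of_hasSeparatedGrowth {E : Set ℝ} (hE : Bornology.IsBounded E)
    (k : ℕ) : ∀ (n : ℕ) (T : (Fin n → ℝ) →ₗ[ℝ] ℝ),
      HasSeparatedGrowth (T '' {x : Fin n → ℝ | ∀ i, x i ∈ E}) (2 ^ k) →
      ∃ (n : ℕ) (T : (Fin n → ℝ) →ₗ[ℝ] ℝ),
        Dense (quotientSet (T '' {x : Fin n → ℝ | ∀ i, x i ∈ E})) := by
  induction k with
  | zero =>
    intro n T h
    refine absurd h (not_hasSeparatedGrowth_one ?_)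
    have hb : Bornology.IsBounded {x : Fin n → ℝ | ∀ i, x i ∈ E} := by
      have := Bornology.IsBounded.pi (S := fun _ : Fin n => E) fun _ => hE
      exact this.subset fun x hx i _ => hx i
    exact (LinearMap.toContinuousLinearMap T).lipschitz.isBounded_image hb
  | succ k ih =>
    intro n T h
    by_cases hd : Dense (quotientSet (T '' {x : Fin n → ℝ | ∀ i, x i ∈ E}))
    · exact ⟨n, T, hd⟩
    simp only [Metric.dense_iff, not_forall, Set.not_nonempty_iff_eq_empty] at hd
    obtain ⟨x, ε, hε, hemp⟩ := hd
    rw [pow_succ'] at h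
    have hfar : ∀ y ∈ quotientSet (T '' {x : Fin n → ℝ | ∀ i, x i ∈ E}), ε ≤ |y - x| := by
      intro y hy
      by_contra hlt
      have : y ∈ Metric.ball x ε ∩ quotientSet (T '' {x : Fin n → ℝ | ∀ i, x i ∈ E}) :=
        ⟨by rw [Metric.mem_ball, Real.dist_eq]; exact not_le.1 hlt, hy⟩
      rw [hemp] at this
      exact this
    refine ih (n + n) (T ∘ₗ LinearMap.funLeft ℝ ℝ (Fin.castAdd n)
      - x • (T ∘ₗ LinearMap.funLeft ℝ ℝ (Fin.natAdd n))) ((h.sub_mul hε hfar).mono ?_)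
    rintro z ⟨_, ⟨u, hu, rfl⟩, _, ⟨v, hv, rfl⟩, rfl⟩
    refine ⟨Fin.append u v, fun i => ?_, ?_⟩
    · refine Fin.addCases (fun i => ?_) (fun i => ?_) i
      · rw [Fin.append_left]; exact hu i
      · rw [Fin.append_right]; exact hv i
    · have h1 : LinearMap.funLeft ℝ ℝ (Fin.castAdd n) (Fin.append u v) = u := by
        ext i; simp [LinearMap.funLeft_apply]
      have h2 : LinearMap.funLeft ℝ ℝ (Fin.natAdd n) (Fin.append u v) = v := by
        ext i; rw [LinearMap.funLeft_apply, Fin.append_right]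
      simp [h1, h2]

/-- A set whose external covering number exceeds `y` contains a finite separated set with more
than `y` elements. -/
theorem exists_finset_separated_of_lt_externalCoveringNumber {E : Set ℝ} {r : ℝ≥0} {y : ℝ≥0∞}
    (hy : y < ((Metric.externalCoveringNumber r E : ℕ∞) : ℝ≥0∞)) :
    ∃ F : Finset ℝ, (F : Set ℝ) ⊆ E ∧ (∀ a ∈ F, ∀ b ∈ F, a ≠ b → (r : ℝ) ≤ |a - b|) ∧
      y < (F.card : ℝ≥0∞) := by
  obtain ⟨N, hyN, hN⟩ : ∃ N : ℕ, y < (N : ℝ≥0∞) ∧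
      (N : ℕ∞) ≤ Metric.externalCoveringNumber r E := by
    cases hc : Metric.externalCoveringNumber r E with
    | top =>
      rw [hc] at hy
      obtain ⟨N, hN⟩ := ENNReal.exists_nat_gt hy.ne
      exact ⟨N, hN, le_top⟩
    | coe N =>
      rw [hc] at hy
      exact ⟨N, by simpa using hy, le_rfl⟩
  rcases Nat.eq_zero_or_pos N with rfl | hN0
  · simp at hyN
  -- The packing number is a supremum; being strictly above N - 1 yields a separated set with at
  -- least N points.
  have hlt : ((N - 1 : ℕ) : ℕ∞) < Metric.packingNumber r E :=
    lt_of_lt_of_le (by exact_mod_cast Nat.sub_lt hN0 one_pos)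
      (hN.trans ((Metric.externalCoveringNumber_le_coveringNumber r E).trans
        (Metric.coveringNumber_le_packingNumber r E)))
  simp only [Metric.packingNumber, lt_iSup_iff] at hlt
  obtain ⟨C, hCE, hC, hlt⟩ := hlt
  have hNC : (N : ℕ∞) ≤ C.encard := by
    have := Order.add_one_le_of_lt hlt
    have h2 : ((N - 1 : ℕ) : ℕ∞) + 1 = N := by
      exact_mod_cast Nat.sub_add_cancel hN0
    rwa [h2] at this
  obtain ⟨t, htC, ht⟩ := Set.exists_subset_encard_eq hNC
  have hfin : t.Finite := Set.finite_of_encard_eq_coe ht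
  refine ⟨hfin.toFinset, by simpa using htC.trans hCE, ?_, ?_⟩
  · intro a ha b hb hab
    have : (r : ℝ≥0∞) < edist a b :=
      hC (htC (by simpa using ha)) (htC (by simpa using hb)) hab
    rw [edist_dist, ← ENNReal.ofReal_coe_nnreal, Real.dist_eq] at this
    exact (ENNReal.ofReal_lt_ofReal_iff_of_nonneg r.2).1 this |>.le
  · rw [hfin.encard_eq_coe_toFinset_card] at ht
    have : hfin.toFinset.card = N := by exact_mod_cast ht
    rwa [this]

theorem exists_hasSeparatedGrowth_of_upperMinkowskiDim_pos {E : Set ℝ}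
    (hdim : 0 < upperMinkowskiDim E) : ∃ k : ℕ, HasSeparatedGrowth E (2 ^ k) := by
  obtain ⟨s, hs0, hs⟩ := EReal.lt_iff_exists_real_btwn.1 hdim
  have hs0 : 0 < s := by exact_mod_cast hs0
  -- With 2^k s ≥ 2, |F| > r^(-s) gives |F|^(2^k) r ≥ 1/r, which exceeds K once r < 1/(1 + |K|). The
  -- limsup supplies such r arbitrarily near 0.
  obtain ⟨k, hk⟩ := pow_unbounded_of_one_lt (2 / s) one_lt_two
  have hk : 2 ≤ 2 ^ k * s := ((div_lt_iff₀ hs0).1 hk).le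
  refine ⟨k, fun K => ?_⟩
  have hfreq := frequently_lt_of_lt_limsup (by isBoundedDefault) hs
  have hδ : (0 : ℝ≥0) < 1 / (1 + ‖K‖₊) := by positivity
  have hev : ∀ᶠ r : ℝ≥0 in 𝓝[>] 0, r ∈ Set.Ioo (0 : ℝ≥0) (1 / (1 + ‖K‖₊)) :=
    Ioo_mem_nhdsGT hδ
  obtain ⟨r, hlt, hr0, hr1⟩ := (hfreq.and_eventually hev).exists
  have hr0 : (0 : ℝ) < r := hr0
  have hr1 : (r : ℝ) < 1 / (1 + |K|) := by exact_mod_cast hr1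
  rw [lt_div_iff₀ (by positivity)] at hr1
  have hrlt : (r : ℝ) < 1 := by nlinarith [abs_nonneg K]
  have hL : 0 < Real.log (1 / r) := Real.log_pos (by rw [lt_div_iff₀ hr0]; linarith)
  rw [EReal.lt_div_iff (by exact_mod_cast hL) (EReal.coe_ne_top _), ← EReal.coe_mul,
    ← Real.log_rpow (by positivity), ← ENNReal.log_ofReal_of_pos (by positivity),
    ENNReal.log_lt_log_iff] at hlt
  obtain ⟨F, hFE, hF, hcard⟩ := exists_finset_separated_of_lt_externalCoveringNumber hlt
  refine ⟨r, hr0, hrlt, F, hFE, hF, ?_⟩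
  rw [← ENNReal.ofReal_natCast, ENNReal.ofReal_lt_ofReal_iff_of_nonneg (by positivity)] at hcard
  have h1r : 1 ≤ 1 / (r : ℝ) := by rw [le_div_iff₀ hr0]; linarith
  have hpow : (1 / (r : ℝ)) ^ 2 ≤ (F.card : ℝ) ^ 2 ^ k := by
    calc (1 / (r : ℝ)) ^ 2 = (1 / (r : ℝ)) ^ (2 : ℝ) := by norm_cast
      _ ≤ (1 / (r : ℝ)) ^ (s * (2 ^ k : ℕ)) :=
          Real.rpow_le_rpow_of_exponent_le h1r (by push_cast; linarith)
      _ = ((1 / (r : ℝ)) ^ s) ^ 2 ^ k := by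
          rw [Real.rpow_mul (by positivity), Real.rpow_natCast]
      _ ≤ (F.card : ℝ) ^ 2 ^ k := by gcongr
  calc K ≤ 1 / r := by
        rw [le_div_iff₀ hr0]
        nlinarith [le_abs_self K]
    _ = (1 / (r : ℝ)) ^ 2 * r := by field_simp
    _ ≤ (F.card : ℝ) ^ 2 ^ k * r := by gcongr

theorem mainTheorem2 (E : Set ℝ) (hE : Bornology.IsBounded E) (hdim : 0 < upperMinkowskiDim E) :
    ∃ (n : ℕ) (T : (Fin n → ℝ) →ₗ[ℝ] ℝ),
      Dense (quotientSet (T '' {x : Fin n → ℝ | ∀ i, x i ∈ E})) := by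
  obtain ⟨k, hk⟩ := exists_hasSeparatedGrowth_of_upperMinkowskiDim_pos hdim
  refine exists_dense_quotientSet_of_hasSeparatedGrowth hE k 1 (LinearMap.proj 0) (hk.mono ?_)
  exact fun x hx => ⟨fun _ => x, fun _ => hx, rfl⟩
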